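/- Let $H$ be a complex Hilbert space, $\mathcal B(H)$ the bounded operators on $H$ with the weak$^*$-topology given by the predual $\mathcal B(H)_*$, and $HS(H)\subseteq\mathcal B(H)$ the Hilbert--Schmidt operators with the Hilbert--Schmidt norm. Let $M\subseteq\mathcal B(H)$ be a von Neumann algebra with commutant $M'$. A \emph{quantum relation} over $M$ is a weak$^*$-closed linear subspace $\mathcal S\subseteq\mathcal B(H)$ with $a x b\in\mathcal S$ for all $x\in\mathcal S$ and $a,b\in M'$. An \emph{HS quantum relation} over $M$ is a linear subspace $V\subseteq HS(H)$ that is closed for the Hilbert--Schmidt norm and satisfies $axb\in V$ for all $x\in V$ and $a,b\in M'$. For a weak$^*$-closed subspace $\mathcal S\subseteq\mathcal B(H)$ let $\mathcal S_{HS}$ be the closure of $\mathcal S\cap HS(H)$ in the Hilbert--Schmidt norm; for a subspace $V\subseteq HS(H)$ let $V_{w^*}$ be the weak$^*$-closure of $V$ in $\mathcal B(H)$. Put $\mathcal S^{hsh}=(\mathcal S_{HS})_{w^*}$ and $V^{hsc}=(V_{w^*})_{HS}$. Then $\mathcal S_{HS}=\mathcal S\cap HS(H)$ for every quantum relation $\mathcal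 S$ over $M$; moreover \[ \{\mathcal S_{HS} : \mathcal S \text{ a quantum relation over } M\} = \{V : V \text{ an HS quantum relation over } M,\ V=V^{hsc}\}, \] \[ \{V_{w^*} : V \text{ an HS quantum relation over } M\} = \{\mathcal S : \mathcal S \text{ a quantum relation over } M,\ \mathcal S=\mathcal S^{hsh}\}, \] and the maps $\mathcal S\mapsto\mathcal S_{HS}$ and $V\mapsto V_{w^*}$ restrict to mutually inverse bijections between these two sets. -/

import Mathlib

open scoped InnerProductSpace ENNReal

noncomputable section

namespace HSQuantum

variable (H : Type*) [NormedAddCommGroup H] [InnerProductSpace ℂ H] [CompleteSpace H]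

/-! ### Hilbert–Schmidt operators -/

/-- The index set of a fixed orthonormal (Hilbert) basis of `H`. -/
def basisIndex : Set H := (exists_hilbertBasis ℂ H).choose

/-- A fixed orthonormal (Hilbert) basis of `H`. -/
def basis : HilbertBasis (basisIndex H) ℂ H := (exists_hilbertBasis ℂ H).choose_spec.choose

/-- The subspace of `B(H)` of the operators `x` with `∑ i, ‖x (e i)‖ ^ 2 < ∞`, for the fixed
orthonormal basis `e`; by `tsum_enorm_sq_eq` below the sum does not depend on the basis. -/
def hsSubmodule : Submodule ℂ (H →L[ℂ] H) where
  carrier := {x | Memℓp (fun i => x (basis H i)) 2}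
  zero_mem' := zero_memℓp
  add_mem' hx hy := hx.add hy
  smul_mem' c _ hx := hx.const_smul c

/-- The space `HS(H)` of Hilbert–Schmidt operators. It is a type of its own, because its norm is
the Hilbert–Schmidt norm and not the operator norm. -/
def HilbertSchmidt : Type _ := hsSubmodule H

instance : AddCommGroup (HilbertSchmidt H) := inferInstanceAs (AddCommGroup (hsSubmodule H))

instance : Module ℂ (HilbertSchmidt H) := inferInstanceAs (Module ℂ (hsSubmodule H))

/-- The inclusion `HS(H) ⊆ B(H)`. -/
def toOp : HilbertSchmidt H →ₗ[ℂ] (H →L[ℂ] H) := (hsSubmodule H).subtype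

/-- A Hilbert–Schmidt operator `x` as the square-summable family `i ↦ x (e i)`. -/
def toL2 : HilbertSchmidt H →ₗ[ℂ] lp (fun _ : basisIndex H => H) 2 where
  toFun x := ⟨fun i => toOp H x (basis H i), x.2⟩
  map_add' _ _ := rfl
  map_smul' _ _ := rfl

theorem toL2_injective : Function.Injective (toL2 H) := by
  intro x y h
  have h1 : ∀ i, toOp H x (basis H i) = toOp H y (basis H i) := fun i =>
    congrArg (fun f : lp (fun _ : basisIndex H => H) 2 => f i) h
  apply Subtype.ext
  refine ContinuousLinearMap.ext_on (s := Set.range (basis H)) ?_ ?_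
  · have := (basis H).dense_span
    rw [Submodule.dense_iff_topologicalClosure_eq_top]
    exact this
  · rintro _ ⟨i, rfl⟩
    exact h1 i

/-- The Hilbert–Schmidt norm `(∑ i, ‖x (e i)‖ ^ 2) ^ (1 / 2)` on `HS(H)`. -/
instance : NormedAddCommGroup (HilbertSchmidt H) :=
  NormedAddCommGroup.induced _ _ (toL2 H) (toL2_injective H)

instance : NormedSpace ℂ (HilbertSchmidt H) := NormedSpace.induced ℂ _ _ (toL2 H)

variable {H}

theorem norm_sq_eq (x : HilbertSchmidt H) :
    ‖x‖ ^ 2 = ∑' i, ‖toOp H x (basis H i)‖ ^ 2 := by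
  have h := lp.norm_rpow_eq_tsum (p := 2) (by norm_num) (toL2 H x)
  have h2 : ‖x‖ = ‖toL2 H x‖ := rfl
  rw [h2]
  simp only [ENNReal.toReal_ofNat, Real.rpow_ofNat] at h
  exact h

theorem tsum_enorm_inner_sq {ι : Type*} (b : HilbertBasis ι ℂ H) (v : H) :
    ∑' i, ‖⟪b i, v⟫_ℂ‖ₑ ^ 2 = ‖v‖ₑ ^ 2 := by
  have h := lp.norm_rpow_eq_tsum (p := 2) (by norm_num) (b.repr v)
  have hs := (lp.memℓp (b.repr v)).summable (by norm_num)
  simp only [ENNReal.toReal_ofNat, Real.rpow_ofNat, LinearIsometryEquiv.norm_map,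
    HilbertBasis.repr_apply_apply] at h hs
  have e : ∀ {E : Type _} [NormedAddCommGroup E] (w : E), ‖w‖ₑ ^ 2 = ENNReal.ofReal (‖w‖ ^ 2) := by
    intro E _ w
    rw [ENNReal.ofReal_pow (norm_nonneg _), ofReal_norm]
  have e' : ∀ w : ℂ, ‖w‖ₑ ^ 2 = ENNReal.ofReal (‖w‖ ^ 2) := by
    intro w
    rw [ENNReal.ofReal_pow (norm_nonneg _), ofReal_norm]
  rw [e, h, ENNReal.ofReal_tsum_of_nonneg (fun _ => by positivity) hs]
  simp only [e']

theorem tsum_enorm_sq_eq_adjoint {ι κ : Type*} (b : HilbertBasis ι ℂ H)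
    (c : HilbertBasis κ ℂ H) (x : H →L[ℂ] H) :
    ∑' i, ‖x (b i)‖ₑ ^ 2 = ∑' j, ‖x.adjoint (c j)‖ₑ ^ 2 := by
  calc ∑' i, ‖x (b i)‖ₑ ^ 2 = ∑' i, ∑' j, ‖⟪c j, x (b i)⟫_ℂ‖ₑ ^ 2 :=
        tsum_congr fun i => (tsum_enorm_inner_sq c _).symm
    _ = ∑' j, ∑' i, ‖⟪c j, x (b i)⟫_ℂ‖ₑ ^ 2 := ENNReal.tsum_comm
    _ = ∑' j, ∑' i, ‖⟪b i, x.adjoint (c j)⟫_ℂ‖ₑ ^ 2 := by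
        refine tsum_congr fun j => tsum_congr fun i => ?_
        rw [ContinuousLinearMap.adjoint_inner_right, ← enorm_norm, norm_inner_symm, enorm_norm]
    _ = ∑' j, ‖x.adjoint (c j)‖ₑ ^ 2 := tsum_congr fun j => tsum_enorm_inner_sq b _

/-- The sum that defines the Hilbert–Schmidt norm does not depend on the orthonormal basis. -/
theorem tsum_enorm_sq_eq {ι κ : Type*} (b : HilbertBasis ι ℂ H) (c : HilbertBasis κ ℂ H)
    (x : H →L[ℂ] H) : ∑' i, ‖x (b i)‖ₑ ^ 2 = ∑' j, ‖x (c j)‖ₑ ^ 2 :=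
  (tsum_enorm_sq_eq_adjoint b c x).trans (tsum_enorm_sq_eq_adjoint c c x).symm

/-! ### The weak* topology on `B(H)` -/

variable (H)

/-- The vector functional `x ↦ ⟪ξ, x η⟫` on `B(H)`. -/
def vectorFunctional (ξ η : H) : StrongDual ℂ (H →L[ℂ] H) :=
  (innerSL ℂ ξ).comp (ContinuousLinearMap.apply ℂ H η)

/-- The predual of `B(H)`, as the closed linear span of the vector functionals in the dual of
the Banach space `B(H)`; it consists of the functionals `x ↦ Tr (x a)` with `a` of trace class. -/
def predual : Submodule ℂ (StrongDual ℂ (H →L[ℂ] H)) :=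
  (Submodule.span ℂ
    (Set.range fun p : H × H => vectorFunctional H p.1 p.2)).topologicalClosure

/-- The duality between `B(H)` and its predual. -/
def pairing : (H →L[ℂ] H) →ₗ[ℂ] predual H →ₗ[ℂ] ℂ :=
  LinearMap.mk₂ ℂ (fun x ω => ω.1 x) (fun _ _ ω => map_add ω.1 _ _)
    (fun _ _ ω => map_smul ω.1 _ _) (fun _ _ _ => rfl) (fun _ _ _ => rfl)

/-- `B(H)` with its weak* topology, the topology of pointwise convergence on the predual. -/
abbrev WeakStarOp : Type _ := WeakBilin (pairing H)

/-- The identity map from `B(H)` to `B(H)` with its weak* topology. -/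
def toWeakStar : (H →L[ℂ] H) ≃ₗ[ℂ] WeakStarOp H := LinearEquiv.refl ℂ (H →L[ℂ] H)

variable {H}

/-- The weak* closure of a subspace of `B(H)`. -/
def weakStarClosure (S : Submodule ℂ (H →L[ℂ] H)) : Submodule ℂ (H →L[ℂ] H) :=
  (S.map (toWeakStar H).toLinearMap).topologicalClosure.comap (toWeakStar H).toLinearMap

/-! ### Quantum relations -/

/-- A quantum relation over `M ⊆ B(H)`: a weak* closed subspace of `B(H)` that is a bimodule over
the commutant of `M`. -/
structure IsQuantumRelation (M : VonNeumannAlgebra H) (S : Submodule ℂ (H →L[ℂ] H)) : Prop where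
  isClosed : IsClosed (toWeakStar H '' (S : Set (H →L[ℂ] H)))
  bimodule : ∀ a ∈ M.commutant, ∀ b ∈ M.commutant, ∀ x ∈ S, a * x * b ∈ S

/-- A Hilbert–Schmidt quantum relation over `M ⊆ B(H)`: a subspace of `HS(H)` that is closed for
the Hilbert–Schmidt norm and is a bimodule over the commutant of `M`. -/
structure IsHSQuantumRelation (M : VonNeumannAlgebra H) (V : Submodule ℂ (HilbertSchmidt H)) :
    Prop where
  isClosed : IsClosed (V : Set (HilbertSchmidt H))
  bimodule : ∀ a ∈ M.commutant, ∀ b ∈ M.commutant, ∀ x ∈ V, ∃ y ∈ V,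
    toOp H y = a * toOp H x * b

/-- `S_HS`: the closure, for the Hilbert–Schmidt norm, of `S ∩ HS(H)`. -/
def hsPart (S : Submodule ℂ (H →L[ℂ] H)) : Submodule ℂ (HilbertSchmidt H) :=
  (S.comap (toOp H)).topologicalClosure

/-- `V_{w*}`: the closure of `V ⊆ HS(H) ⊆ B(H)` in the weak* topology of `B(H)`. -/
def wStar (V : Submodule ℂ (HilbertSchmidt H)) : Submodule ℂ (H →L[ℂ] H) :=
  weakStarClosure (V.map (toOp H))

/-- The Hilbert–Schmidt hull `S^{hsh}`. -/
def hsHull (S : Submodule ℂ (H →L[ℂ] H)) : Submodule ℂ (H →L[ℂ] H) := wStar (hsPart S)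

/-- The Hilbert–Schmidt closure `V^{hsc}`. -/
def hsClosure (V : Submodule ℂ (HilbertSchmidt H)) : Submodule ℂ (HilbertSchmidt H) :=
  hsPart (wStar V)

end HSQuantum

end

open scoped InnerProductSpace ENNReal

namespace HSQuantum

variable {H : Type*} [NormedAddCommGroup H] [InnerProductSpace ℂ H] [CompleteSpace H]

/-! ### The ideal of Hilbert–Schmidt operators -/

theorem mem_hsSubmodule_iff (x : H →L[ℂ] H) :
    x ∈ hsSubmodule H ↔ ∑' i, ‖x (basis H i)‖ₑ ^ 2 ≠ ∞ := by
  change Memℓp (fun i => x (basis H i)) 2 ↔ _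
  rw [memℓp_gen_iff (by norm_num)]
  simp only [ENNReal.toReal_ofNat, Real.rpow_ofNat]
  have e : ∀ i, ‖x (basis H i)‖ₑ ^ 2 = ((‖x (basis H i)‖₊ ^ 2 : NNReal) : ℝ≥0∞) := by
    intro i
    rw [ENNReal.coe_pow]
    rfl
  simp only [e]
  rw [ENNReal.tsum_coe_ne_top_iff_summable, ← NNReal.summable_coe]
  simp

theorem enorm_sq_eq (x : HilbertSchmidt H) :
    ‖x‖ₑ ^ 2 = ∑' i, ‖toOp H x (basis H i)‖ₑ ^ 2 := by
  have hs : Summable fun i => ‖toOp H x (basis H i)‖ ^ 2 := by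
    have h : Memℓp (fun i => toOp H x (basis H i)) 2 := x.2
    simpa using h.summable (by norm_num)
  rw [← ofReal_norm, ← ENNReal.ofReal_pow (norm_nonneg _), norm_sq_eq,
    ENNReal.ofReal_tsum_of_nonneg (fun _ => by positivity) hs]
  refine tsum_congr fun i => ?_
  rw [ENNReal.ofReal_pow (norm_nonneg _), ofReal_norm]

/-- The operator norm is dominated by the Hilbert–Schmidt norm. -/
theorem norm_toOp_le (x : HilbertSchmidt H) : ‖toOp H x‖ ≤ ‖x‖ := by
  refine ContinuousLinearMap.opNorm_le_bound _ (norm_nonneg _) fun v => ?_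
  have key : ‖toOp H x v‖ₑ ^ 2 ≤ (‖x‖ₑ * ‖v‖ₑ) ^ 2 := by
    rw [← tsum_enorm_inner_sq (basis H), mul_pow, enorm_sq_eq,
      tsum_enorm_sq_eq_adjoint (basis H) (basis H), ← ENNReal.tsum_mul_right]
    refine ENNReal.tsum_le_tsum fun i => ?_
    rw [← ContinuousLinearMap.adjoint_inner_left, ← mul_pow]
    gcongr
    simp only [← ofReal_norm]
    rw [← ENNReal.ofReal_mul (norm_nonneg _)]
    exact ENNReal.ofReal_le_ofReal (norm_inner_le_norm _ _)
  rw [ENNReal.pow_le_pow_left_iff two_ne_zero] at key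
  simp only [← ofReal_norm] at key
  rw [← ENNReal.ofReal_mul (norm_nonneg _)] at key
  exact (ENNReal.ofReal_le_ofReal_iff (by positivity)).1 key

theorem continuous_toOp : Continuous (toOp H) :=
  AddMonoidHomClass.continuous_of_bound (toOp H) 1 fun x => by
    simpa using norm_toOp_le x

theorem mul_mem_hsSubmodule (a : H →L[ℂ] H) {x : H →L[ℂ] H} (hx : x ∈ hsSubmodule H) :
    a * x ∈ hsSubmodule H := by
  rw [mem_hsSubmodule_iff] at hx ⊢
  refine ne_top_of_le_ne_top (ENNReal.mul_ne_top (a := ‖a‖ₑ ^ 2) (by finiteness) hx) ?_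
  rw [← ENNReal.tsum_mul_left]
  refine ENNReal.tsum_le_tsum fun i => ?_
  rw [← mul_pow]
  gcongr
  exact a.le_opENorm _

theorem adjoint_mem_hsSubmodule {x : H →L[ℂ] H} (hx : x ∈ hsSubmodule H) :
    x.adjoint ∈ hsSubmodule H := by
  rw [mem_hsSubmodule_iff] at hx ⊢
  rwa [← tsum_enorm_sq_eq_adjoint (basis H) (basis H)]

theorem mul_mem_hsSubmodule_right {x : H →L[ℂ] H} (hx : x ∈ hsSubmodule H) (b : H →L[ℂ] H) :
    x * b ∈ hsSubmodule H := by
  have h := adjoint_mem_hsSubmodule (mul_mem_hsSubmodule b.adjoint (adjoint_mem_hsSubmodule hx))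
  simp only [← ContinuousLinearMap.star_eq_adjoint] at h
  simpa using h

theorem mem_hsSubmodule_toOp (x : HilbertSchmidt H) : toOp H x ∈ hsSubmodule H := x.2

/-! ### Weak* continuity -/

theorem mem_weakStarClosure {S : Submodule ℂ (H →L[ℂ] H)} {x : H →L[ℂ] H} :
    x ∈ weakStarClosure S ↔
      toWeakStar H x ∈ closure (toWeakStar H '' (S : Set (H →L[ℂ] H))) :=
  Iff.rfl

theorem le_weakStarClosure (S : Submodule ℂ (H →L[ℂ] H)) : S ≤ weakStarClosure S :=
  fun _ hx => mem_weakStarClosure.2 (subset_closure (Set.mem_image_of_mem (toWeakStar H) hx))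

theorem isClosed_toWeakStar_image_iff {S : Submodule ℂ (H →L[ℂ] H)} :
    IsClosed (toWeakStar H '' (S : Set (H →L[ℂ] H))) ↔ weakStarClosure S = S := by
  constructor
  · intro h
    refine le_antisymm (fun x hx => ?_) (le_weakStarClosure S)
    rw [mem_weakStarClosure, h.closure_eq] at hx
    obtain ⟨y, hy, hxy⟩ := hx
    rwa [← (toWeakStar H).injective hxy]
  · intro h
    refine closure_subset_iff_isClosed.1 fun x hx => ?_
    refine ⟨(toWeakStar H).symm x, ?_, by simp⟩
    rw [SetLike.mem_coe, ← h]
    exact hx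

theorem isClosed_weakStarClosure (S : Submodule ℂ (H →L[ℂ] H)) :
    IsClosed (toWeakStar H '' (weakStarClosure S : Set (H →L[ℂ] H))) := by
  have h : toWeakStar H '' (weakStarClosure S : Set (H →L[ℂ] H)) =
      closure (toWeakStar H '' (S : Set (H →L[ℂ] H))) :=
    Set.image_preimage_eq _ (toWeakStar H).surjective
  rw [h]
  exact isClosed_closure

theorem weakStarClosure_le_iff {S T : Submodule ℂ (H →L[ℂ] H)}
    (hT : IsClosed (toWeakStar H '' (T : Set (H →L[ℂ] H)))) :
    weakStarClosure S ≤ T ↔ S ≤ T := by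
  refine ⟨(le_weakStarClosure S).trans, fun h => ?_⟩
  rw [isClosed_toWeakStar_image_iff] at hT
  rw [← hT]
  exact fun x hx => closure_mono (Set.image_mono (f := toWeakStar H) h) hx

theorem continuous_toWeakStar : Continuous (toWeakStar H) :=
  WeakBilin.continuous_of_continuous_eval _ fun ω => ω.1.continuous

/-- Composition with a two-sided multiplication preserves the predual. -/
theorem comp_mulLeftRight_mem_predual (a b : H →L[ℂ] H) {ω : StrongDual ℂ (H →L[ℂ] H)}
    (hω : ω ∈ predual H) :
    ω.comp (ContinuousLinearMap.mulLeftRight ℂ (H →L[ℂ] H) a b) ∈ predual H := by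
  have hc : Continuous fun ω : StrongDual ℂ (H →L[ℂ] H) =>
      ω.comp (ContinuousLinearMap.mulLeftRight ℂ (H →L[ℂ] H) a b) := by fun_prop
  have hspan : ∀ ω ∈ Submodule.span ℂ
      (Set.range fun p : H × H => vectorFunctional H p.1 p.2),
      ω.comp (ContinuousLinearMap.mulLeftRight ℂ (H →L[ℂ] H) a b) ∈ predual H := by
    intro ω hω
    induction hω using Submodule.span_induction with
    | mem ω h =>
      obtain ⟨⟨ξ, η⟩, rfl⟩ := h
      refine Submodule.le_topologicalClosure _ (Submodule.subset_span ⟨(a.adjoint ξ, b η), ?_⟩)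
      ext x
      simp [vectorFunctional, ContinuousLinearMap.adjoint_inner_left]
    | zero => simp
    | add ω₁ ω₂ _ _ h₁ h₂ => simpa using add_mem h₁ h₂
    | smul c ω _ h => simpa using Submodule.smul_mem _ c h
  exact closure_minimal hspan
    ((Submodule.isClosed_topologicalClosure _).preimage hc) hω

theorem continuous_mul_mul_weakStar (a b : H →L[ℂ] H) :
    Continuous fun x : WeakStarOp H => toWeakStar H (a * (toWeakStar H).symm x * b) :=
  WeakBilin.continuous_of_continuous_eval _ fun ω =>
    WeakBilin.eval_continuous (pairing H) ⟨_, comp_mulLeftRight_mem_predual a b ω.2⟩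

theorem weakStarClosure_bimodule {a b : H →L[ℂ] H} {S : Submodule ℂ (H →L[ℂ] H)}
    (hS : ∀ x ∈ S, a * x * b ∈ S) {x : H →L[ℂ] H} (hx : x ∈ weakStarClosure S) :
    a * x * b ∈ weakStarClosure S := by
  have hmaps : Set.MapsTo (fun x : WeakStarOp H => toWeakStar H (a * (toWeakStar H).symm x * b))
      (toWeakStar H '' (S : Set (H →L[ℂ] H))) (toWeakStar H '' (S : Set (H →L[ℂ] H))) := by
    rintro _ ⟨y, hy, rfl⟩
    exact ⟨_, hS y hy, by simp⟩
  exact hmaps.closure (continuous_mul_mul_weakStar a b) hx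

/-! ### The two constructions -/

theorem hsPart_eq_comap {S : Submodule ℂ (H →L[ℂ] H)}
    (hS : IsClosed (toWeakStar H '' (S : Set (H →L[ℂ] H)))) : hsPart S = S.comap (toOp H) := by
  refine IsClosed.submodule_topologicalClosure_eq ?_
  have h := hS.preimage (continuous_toWeakStar.comp (continuous_toOp (H := H)))
  rwa [Set.preimage_comp, Set.preimage_image_eq _ (toWeakStar H).injective] at h

theorem toOp_image_hsPart {S : Submodule ℂ (H →L[ℂ] H)}
    (hS : IsClosed (toWeakStar H '' (S : Set (H →L[ℂ] H)))) :
    toOp H '' (hsPart S) = (S : Set (H →L[ℂ] H)) ∩ hsSubmodule H := by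
  rw [hsPart_eq_comap hS]
  ext x
  constructor
  · rintro ⟨y, hy, rfl⟩
    exact ⟨hy, mem_hsSubmodule_toOp y⟩
  · rintro ⟨hx, hx'⟩
    exact ⟨⟨x, hx'⟩, hx, rfl⟩

theorem isClosed_wStar (V : Submodule ℂ (HilbertSchmidt H)) :
    IsClosed (toWeakStar H '' (wStar V : Set (H →L[ℂ] H))) :=
  isClosed_weakStarClosure _

/-- On weak* closed subspaces, `V ↦ V_{w*}` is left adjoint to `S ↦ S_HS`. -/
theorem wStar_le_iff {V : Submodule ℂ (HilbertSchmidt H)} {S : Submodule ℂ (H →L[ℂ] H)}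
    (hS : IsClosed (toWeakStar H '' (S : Set (H →L[ℂ] H)))) :
    wStar V ≤ S ↔ V ≤ hsPart S := by
  rw [wStar, weakStarClosure_le_iff hS, hsPart_eq_comap hS, Submodule.map_le_iff_le_comap]

theorem le_hsClosure (V : Submodule ℂ (HilbertSchmidt H)) : V ≤ hsClosure V :=
  (wStar_le_iff (isClosed_wStar V)).1 le_rfl

theorem hsHull_le {S : Submodule ℂ (H →L[ℂ] H)}
    (hS : IsClosed (toWeakStar H '' (S : Set (H →L[ℂ] H)))) : hsHull S ≤ S :=
  (wStar_le_iff hS).2 le_rfl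

theorem wStar_mono {V W : Submodule ℂ (HilbertSchmidt H)} (h : V ≤ W) : wStar V ≤ wStar W :=
  (wStar_le_iff (isClosed_wStar W)).2 (h.trans (le_hsClosure W))

theorem hsPart_mono {S T : Submodule ℂ (H →L[ℂ] H)} (h : S ≤ T) : hsPart S ≤ hsPart T :=
  Submodule.topologicalClosure_mono (Submodule.comap_mono h)

theorem hsClosure_hsPart {S : Submodule ℂ (H →L[ℂ] H)}
    (hS : IsClosed (toWeakStar H '' (S : Set (H →L[ℂ] H)))) :
    hsClosure (hsPart S) = hsPart S :=
  le_antisymm (hsPart_mono (hsHull_le hS)) (le_hsClosure _)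

theorem hsHull_wStar (V : Submodule ℂ (HilbertSchmidt H)) : hsHull (wStar V) = wStar V :=
  le_antisymm (hsHull_le (isClosed_wStar V)) (wStar_mono (le_hsClosure V))

theorem IsQuantumRelation.hsPart {M : VonNeumannAlgebra H} {S : Submodule ℂ (H →L[ℂ] H)}
    (hS : IsQuantumRelation M S) : IsHSQuantumRelation M (hsPart S) where
  isClosed := Submodule.isClosed_topologicalClosure _
  bimodule a ha b hb x hx := by
    rw [hsPart_eq_comap hS.isClosed] at hx ⊢
    exact ⟨⟨a * toOp H x * b,
      mul_mem_hsSubmodule_right (mul_mem_hsSubmodule a (mem_hsSubmodule_toOp x)) b⟩,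
      hS.bimodule a ha b hb _ hx, rfl⟩

theorem IsHSQuantumRelation.wStar {M : VonNeumannAlgebra H}
    {V : Submodule ℂ (HilbertSchmidt H)} (hV : IsHSQuantumRelation M V) :
    IsQuantumRelation M (wStar V) where
  isClosed := isClosed_wStar V
  bimodule a ha b hb x hx := by
    refine weakStarClosure_bimodule ?_ hx
    rintro _ ⟨y, hy, rfl⟩
    exact hV.bimodule a ha b hb y hy

end HSQuantum

theorem mainTheorem8 {H : Type*} [NormedAddCommGroup H] [InnerProductSpace ℂ H] [CompleteSpace H]
    (M : VonNeumannAlgebra H) :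
    (∀ S : Submodule ℂ (H →L[ℂ] H), HSQuantum.IsQuantumRelation M S →
      HSQuantum.toOp H '' (HSQuantum.hsPart S) = (S : Set (H →L[ℂ] H)) ∩ HSQuantum.hsSubmodule H) ∧
    {V | ∃ S, HSQuantum.IsQuantumRelation M S ∧ HSQuantum.hsPart S = V} =
      {V | HSQuantum.IsHSQuantumRelation M V ∧ V = HSQuantum.hsClosure V} ∧
    {S | ∃ V, HSQuantum.IsHSQuantumRelation M V ∧ HSQuantum.wStar V = S} =
      {S | HSQuantum.IsQuantumRelation M S ∧ S = HSQuantum.hsHull S} ∧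
    Set.BijOn HSQuantum.hsPart
      {S | HSQuantum.IsQuantumRelation M S ∧ S = HSQuantum.hsHull S}
      {V | HSQuantum.IsHSQuantumRelation M V ∧ V = HSQuantum.hsClosure V} ∧
    Set.BijOn HSQuantum.wStar
      {V | HSQuantum.IsHSQuantumRelation M V ∧ V = HSQuantum.hsClosure V}
      {S | HSQuantum.IsQuantumRelation M S ∧ S = HSQuantum.hsHull S} ∧
    Set.InvOn HSQuantum.wStar HSQuantum.hsPart
      {S | HSQuantum.IsQuantumRelation M S ∧ S = HSQuantum.hsHull S}
      {V | HSQuantum.IsHSQuantumRelation M V ∧ V = HSQuantum.hsClosure V} := by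
  have inv : Set.InvOn HSQuantum.wStar HSQuantum.hsPart
      {S | HSQuantum.IsQuantumRelation M S ∧ S = HSQuantum.hsHull S}
      {V | HSQuantum.IsHSQuantumRelation M V ∧ V = HSQuantum.hsClosure V} :=
    ⟨fun _ hS => hS.2.symm, fun _ hV => hV.2.symm⟩
  have hpart : Set.MapsTo HSQuantum.hsPart
      {S | HSQuantum.IsQuantumRelation M S ∧ S = HSQuantum.hsHull S}
      {V | HSQuantum.IsHSQuantumRelation M V ∧ V = HSQuantum.hsClosure V} :=
    fun _ hS => ⟨hS.1.hsPart, (HSQuantum.hsClosure_hsPart hS.1.isClosed).symm⟩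
  have hstar : Set.MapsTo HSQuantum.wStar
      {V | HSQuantum.IsHSQuantumRelation M V ∧ V = HSQuantum.hsClosure V}
      {S | HSQuantum.IsQuantumRelation M S ∧ S = HSQuantum.hsHull S} :=
    fun V hV => ⟨hV.1.wStar, (HSQuantum.hsHull_wStar V).symm⟩
  refine ⟨fun S hS => HSQuantum.toOp_image_hsPart hS.isClosed, ?_, ?_,
    inv.bijOn hpart hstar, inv.symm.bijOn hstar hpart, inv⟩
  · ext V
    constructor
    · rintro ⟨S, hS, rfl⟩
      exact ⟨hS.hsPart, (HSQuantum.hsClosure_hsPart hS.isClosed).symm⟩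
    · rintro ⟨hV, h⟩
      exact ⟨HSQuantum.wStar V, hV.wStar, h.symm⟩
  · ext S
    constructor
    · rintro ⟨V, hV, rfl⟩
      exact ⟨hV.wStar, (HSQuantum.hsHull_wStar V).symm⟩
    · rintro ⟨hS, h⟩
      exact ⟨HSQuantum.hsPart S, hS.hsPart, h.symm⟩
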